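/- Let $X$ be a Banach space over $\mathbb{F}=\mathbb{R}$ or $\mathbb{C}$, and let $\mathcal{B}(X)$ be the algebra of bounded linear operators on $X$. A subspace lattice on $X$ is a family $\mathcal{L}$ of closed subspaces of $X$ that contains $\{0\}$ and $X$ and is closed under arbitrary closed linear spans $\bigvee$ and arbitrary intersections $\bigwedge$. For $K\in\mathcal{L}$ put $K_-=\bigvee\{M\in\mathcal{L}: K\nsubseteq M\}$, and let $\mathcal{J}(\mathcal{L})=\{K\in\mathcal{L}: K\neq\{0\},\ K_-\neq X\}$. The lattice $\mathcal{L}$ is a $\mathcal{J}$-subspace lattice if $\bigvee\{K: K\in\mathcal{J}(\mathcal{L})\}=X$, $\bigwedge\{K_-: K\in\mathcal{J}(\mathcal{L})\}=\{0\}$, and $K\vee K_-=X$, $K\wedge K_-=\{0\}$ for each $K\in\mathcal{J}(\mathcal{L})$. Let $\mathrm{Alg}\mathcal{L}=\{A\in\mathcal{B}(X): AM\subseteq M \text{ for all } M\in\mathcal{L}\}$, and write $[A,B]=AB-BA$. For a ring $R$ and a sequence $\mathbf{a}=(a_n)_{n\ge 1}$ in $R$, define $$\Delta(\mathbf{a})_n=([a_1,1]*[a_2,2]*\cdots*[a_n,n])_n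 ,$$ where sequences of additive maps $R\to R$ are multiplied by $(d*d')_n=\sum_{i+j=n}d_i\circ d'_j$, and, for $a\in R$ and $k\ge1$, $[a,k]_0(x)=x$, $[a,k]_n(x)=0$ if $k\nmid n$, and $[a,k]_n(x)=a^{r}x-a^{r-1}xa$ if $n=kr\neq0$. **Theorem.** Let $\mathcal{L}$ be a $\mathcal{J}$-subspace lattice on a Banach space $X$ over $\mathbb{F}$, and let $\{L_n\}_{n=0}^\infty$ be a family of linear maps $L_n:\mathrm{Alg}\mathcal{L}\to\mathrm{Alg}\mathcal{L}$ with $L_0=\mathrm{id}$. Then $$L_n([A,B])=\sum_{i+j=n}[L_i(A),L_j(B)]\qquad\text{for all } n\ge0 \text{ and all } A,B\in\mathrm{Alg}\mathcal{L} \text{ with } AB=0$$ if and only if for each $K\in\mathcal{J}(\mathcal{L})$ there exist - a sequence $\mathbf{T}_K=(T_{Kn})_{n}$ in $\mathcal{B}(K)$ and linear maps $\Delta(\mathbf{T})_{Kn}:\mathrm{Alg}\mathcal{L}\to\mathrm{Alg}\mathcal{L}$ $(n\ge1)$ such that $\Delta(\mathbf{T})_{Kn}(A)|_K=\Delta(\mathbf{T}_K)_n(A|_K)$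 for all $n\ge1$ and $A\in\mathrm{Alg}\mathcal{L}$, the right-hand side being formed in the ring $R=\mathcal{B}(K)$; - linear functionals $h_{Kn}:\mathrm{Alg}\mathcal{L}\to\mathbb{F}$ $(n\ge0)$ such that $h_{Kn}([A,B])=0$ whenever $A,B\in\mathrm{Alg}\mathcal{L}$ and $AB=0$; such that $L_n(A)x=(\Delta(\mathbf{T})_{Kn}(A)+h_{Kn}(A)I)x$ for all $n\ge1$, all $A\in\mathrm{Alg}\mathcal{L}$ and all $x\in K$. -/

import Mathlib

section SubspaceLattices

variable {𝕜 X : Type*} [RCLike 𝕜] [NormedAddCommGroup X] [NormedSpace 𝕜 X]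

/-- A subspace lattice of `X`: a family of closed subspaces containing `0` and `X` and closed under
arbitrary closed linear spans (`sSup` of closed submodules) and intersections (`sInf`). -/
structure IsSubspaceLattice (L : Set (ClosedSubmodule 𝕜 X)) : Prop where
  bot_mem : ⊥ ∈ L
  top_mem : ⊤ ∈ L
  sSup_mem : ∀ S ⊆ L, sSup S ∈ L
  sInf_mem : ∀ S ⊆ L, sInf S ∈ L

/-- `K₋ = ⋁ {M ∈ L : K ⊈ M}`. -/
noncomputable def lowerPart (L : Set (ClosedSubmodule 𝕜 X)) (K : ClosedSubmodule 𝕜 X) :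
    ClosedSubmodule 𝕜 X :=
  sSup {M | M ∈ L ∧ ¬ K ≤ M}

/-- `𝒥(L) = {K ∈ L : K ≠ 0 and K₋ ≠ X}`. -/
def setJ (L : Set (ClosedSubmodule 𝕜 X)) : Set (ClosedSubmodule 𝕜 X) :=
  {K | K ∈ L ∧ K ≠ ⊥ ∧ lowerPart L K ≠ ⊤}

/-- `𝒥`-subspace lattices. -/
structure IsJSubspaceLattice (L : Set (ClosedSubmodule 𝕜 X)) : Prop
    extends IsSubspaceLattice L where
  span_setJ : sSup (setJ L) = ⊤
  inter_lowerPart : sInf (lowerPart L '' setJ L) = ⊥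
  sup_lowerPart : ∀ K ∈ setJ L, K ⊔ lowerPart L K = ⊤
  inf_lowerPart : ∀ K ∈ setJ L, K ⊓ lowerPart L K = ⊥

/-- `Alg L`: the algebra of all bounded operators on `X` leaving each member of `L` invariant. -/
def algLat (L : Set (ClosedSubmodule 𝕜 X)) : Subalgebra 𝕜 (X →L[𝕜] X) where
  carrier := {A | ∀ M ∈ L, ∀ x ∈ M, A x ∈ M}
  mul_mem' hA hB M hM x hx := hA M hM _ (hB M hM x hx)
  add_mem' hA hB M hM x hx := add_mem (hA M hM x hx) (hB M hM x hx)
  algebraMap_mem' c M _ x hx := by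
    rw [Algebra.algebraMap_eq_smul_one]
    exact M.toSubmodule.smul_mem c hx

/-- The restriction `A|_K ∈ B(K)` of an operator `A ∈ Alg L` to a member `K` of `L`. -/
def restrictTo {L : Set (ClosedSubmodule 𝕜 X)} {K : ClosedSubmodule 𝕜 X} (hK : K ∈ L)
    (A : algLat L) : K.toSubmodule →L[𝕜] K.toSubmodule :=
  (A : X →L[𝕜] X).restrict (p := K.toSubmodule) (q := K.toSubmodule) (A.2 K hK)

end SubspaceLattices

section InnerHigherDerivations

variable {R : Type*} [Ring R]

/-- The product `(d * d')_n = ∑_{i+j=n} d_i ∘ d'_j` of sequences of additive maps. -/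
def seqConv (d d' : ℕ → R →+ R) (n : ℕ) : R →+ R :=
  ∑ p ∈ Finset.HasAntidiagonal.antidiagonal n, (d p.1).comp (d' p.2)

/-- The sequence `[a, k]`: it is the identity in degree `0`, the map
`x ↦ a ^ r * x - a ^ (r - 1) * x * a` in degree `n = k * r ≠ 0`, and zero in degrees `n` that are
not multiples of `k`. It is used only with `k ≥ 1`. -/
def elemSeq (a : R) (k n : ℕ) : R →+ R :=
  if n = 0 then AddMonoidHom.id R
  else if k ∣ n then
    AddMonoidHom.mulLeft (a ^ (n / k)) -
      (AddMonoidHom.mulLeft (a ^ (n / k - 1))).comp (AddMonoidHom.mulRight a)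
  else 0

/-- The product `[a 1, 1] * [a 2, 2] * ⋯ * [a m, m]`. For `m = 0` this is the neutral sequence
`(id, 0, 0, …)`. -/
def elemProd (a : ℕ → R) : ℕ → ℕ → R →+ R
  | 0, n => if n = 0 then AddMonoidHom.id R else 0
  | m + 1, n => seqConv (elemProd a m) (elemSeq (a (m + 1)) (m + 1)) n

/-- `Δ(a)_n = ([a 1, 1] * [a 2, 2] * ⋯ * [a n, n])_n`. The value `a 0` is not used. -/
def innerHigherDer (a : ℕ → R) (n : ℕ) : R →+ R :=
  elemProd a n n

end InnerHigherDerivations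

/-! ### Inner higher derivations as conjugations of power series -/

section HigherDerivations

variable {R : Type*} [Ring R]

/-! Each `[a, k]` is conjugation by `(1 - a X^k)⁻¹` in `R⟦X⟧`, restricted to constants, so the
products, and hence `Δ`, satisfy Leibniz' rule (`innerHigherDer_mul`). Scalars disappear in
commutators. Thus maps `Δ_n + h_n` satisfy the Lie identity wherever `h_n` kills the commutator; as
the `K` in `𝒥` span `X`, checking this on each `K` suffices.

Conversely, fix `K`. Suppose `T_1, …, T_k` represent `L_1, …, L_k` on `K` up to scalars. Subtracting
the degree `k + 1` part of `[T_1,1] * ⋯ * [T_k,k]` from `L_{k+1}` leaves a map `δ` that is Lie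
derivable at zero products (`map_sub_elemProd_lie`), since all intermediate terms cancel. Such a `δ`
is `[T, ·]` plus a scalar map (`exists_eq_lie_add_smul`), and `T` serves as `T_{k+1}`.

That degree one result uses the operators `x ⊗ f` with `x ∈ K` and `f` zero on `K₋`. They lie in
`Alg L` and are combinations of idempotents, which extends the Lie identity from zero products to
all `[a, x ⊗ f]`. Inner corrections then make `δ` scalar on every `x ⊗ f`, and therefore everywhere.
-/

open PowerSeries in
/-- `d` is the sequence of coefficients of an inner automorphism of `R⟦X⟧`, restricted to `R`. -/
def IsInnerSeq (d : ℕ → R →+ R) : Prop :=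
  ∃ U V : R⟦X⟧, V * U = 1 ∧ ∀ n x, d n x = coeff n (U * C x * V)

theorem IsInnerSeq.map_mul {d : ℕ → R →+ R} (hd : IsInnerSeq d) (n : ℕ) (x y : R) :
    d n (x * y) = ∑ p ∈ Finset.HasAntidiagonal.antidiagonal n, d p.1 x * d p.2 y := by
  obtain ⟨U, V, hVU, h⟩ := hd
  have : U * PowerSeries.C (x * y) * V =
      (U * PowerSeries.C x * V) * (U * PowerSeries.C y * V) := by
    calc U * PowerSeries.C (x * y) * V
        = U * PowerSeries.C x * 1 * PowerSeries.C y * V := by simp [mul_assoc]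
      _ = _ := by rw [← hVU]; simp only [mul_assoc]
  rw [h, this, PowerSeries.coeff_mul]
  simp only [h]

/-- With `P` itself a conjugate of a constant, this turns composed conjugations into `seqConv`. -/
theorem PowerSeries.coeff_mul_mul_eq_sum (U P V : PowerSeries R) (n : ℕ) :
    PowerSeries.coeff n (U * P * V) = ∑ p ∈ Finset.HasAntidiagonal.antidiagonal n,
      PowerSeries.coeff p.1 (U * PowerSeries.C (PowerSeries.coeff p.2 P) * V) := by
  simp only [PowerSeries.coeff_mul _ _ V, PowerSeries.coeff_mul_C]
  simp only [PowerSeries.coeff_mul _ U P, Finset.sum_mul]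
  rw [Finset.sum_sigma', Finset.sum_sigma']
  -- The terms are `U_i P_j V_l`; grouping `(i, j)` first is exchanged with grouping `(i, l)` first,
  -- by an involution.
  refine Finset.sum_nbij' (fun q => ⟨(q.2.1 + q.1.2, q.2.2), (q.2.1, q.1.2)⟩)
    (fun q => ⟨(q.2.1 + q.1.2, q.2.2), (q.2.1, q.1.2)⟩) ?_ ?_ ?_ ?_ ?_
  · rintro ⟨⟨a, b⟩, c, d⟩ h
    simp only [Finset.mem_sigma, Finset.HasAntidiagonal.mem_antidiagonal] at h ⊢
    exact ⟨by omega, trivial⟩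
  · rintro ⟨⟨a, b⟩, c, d⟩ h
    simp only [Finset.mem_sigma, Finset.HasAntidiagonal.mem_antidiagonal] at h ⊢
    exact ⟨by omega, trivial⟩
  · rintro ⟨⟨a, b⟩, c, d⟩ h
    simp only [Finset.mem_sigma, Finset.HasAntidiagonal.mem_antidiagonal] at h ⊢
    simp [h.2]
  · rintro ⟨⟨a, b⟩, c, d⟩ h
    simp only [Finset.mem_sigma, Finset.HasAntidiagonal.mem_antidiagonal] at h ⊢
    simp [h.2]
  · rintro ⟨⟨a, b⟩, c, d⟩ h
    rfl

theorem seqConv_apply (d d' : ℕ → R →+ R) (n : ℕ) (x : R) :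
    seqConv d d' n x = ∑ p ∈ Finset.HasAntidiagonal.antidiagonal n, d p.1 (d' p.2 x) := by
  simp [seqConv, AddMonoidHom.finsetSum_apply]

theorem IsInnerSeq.seqConv {d d' : ℕ → R →+ R} (hd : IsInnerSeq d) (hd' : IsInnerSeq d') :
    IsInnerSeq (seqConv d d') := by
  obtain ⟨U, V, hVU, h⟩ := hd
  obtain ⟨U', V', hVU', h'⟩ := hd'
  refine ⟨U * U', V' * V, ?_, fun n x => ?_⟩
  · calc V' * V * (U * U') = V' * (V * U) * U' := by simp only [mul_assoc]
      _ = 1 := by rw [hVU, mul_one, hVU']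
  · have : U * U' * PowerSeries.C x * (V' * V) = U * (U' * PowerSeries.C x * V') * V := by
      simp only [mul_assoc]
    rw [this, PowerSeries.coeff_mul_mul_eq_sum, seqConv_apply]
    simp only [h, h']

/-- The conjugating series is the geometric series `∑ a^r X^(kr)`, inverse to `1 - a X^k`. -/
theorem elemSeq_isInnerSeq (a : R) {k : ℕ} (hk : 1 ≤ k) : IsInnerSeq (elemSeq a k) := by
  set U : PowerSeries R := PowerSeries.mk fun n => if k ∣ n then a ^ (n / k) else 0 with hU
  refine ⟨U, 1 - PowerSeries.C a * PowerSeries.X ^ k, ?_, fun n x => ?_⟩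
  · ext n
    rw [sub_mul, one_mul, map_sub, mul_assoc, PowerSeries.coeff_C_mul,
      PowerSeries.coeff_X_pow_mul', PowerSeries.coeff_one]
    simp only [hU, PowerSeries.coeff_mk]
    by_cases hn : k ∣ n
    · obtain ⟨r, rfl⟩ := hn
      rcases r with _ | r
      · have : k ≠ 0 := by omega
        simp [this]
      · have h1 : k ≤ k * (r + 1) := Nat.le_mul_of_pos_right k (by omega)
        have h2 : k * (r + 1) - k = k * r := by rw [Nat.mul_succ]; omega
        have h3 : k * (r + 1) ≠ 0 := by positivity
        simp [h1, h2, h3, Nat.mul_div_cancel_left _ (show 0 < k by omega), pow_succ']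
    · have h3 : n ≠ 0 := by rintro rfl; simp at hn
      by_cases hkn : k ≤ n
      · have : ¬ k ∣ n - k := fun h =>
          hn (Nat.sub_add_cancel hkn ▸ Nat.dvd_add h (dvd_refl k))
        simp [hn, hkn, this, h3]
      · simp [hn, hkn, h3]
  · rw [mul_sub, mul_one, map_sub, ← mul_assoc, PowerSeries.coeff_mul_X_pow']
    simp only [PowerSeries.coeff_mul_C, hU, PowerSeries.coeff_mk, elemSeq]
    by_cases hn : k ∣ n
    · obtain ⟨r, rfl⟩ := hn
      rcases r with _ | r
      · have : k ≠ 0 := by omega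
        simp [this]
      · have h1 : k ≤ k * (r + 1) := Nat.le_mul_of_pos_right k (by omega)
        have h2 : k * (r + 1) - k = k * r := by rw [Nat.mul_succ]; omega
        have h3 : k * (r + 1) ≠ 0 := by positivity
        simp [h1, h2, h3, Nat.mul_div_cancel_left _ (show 0 < k by omega), mul_assoc]
    · have h3 : n ≠ 0 := by rintro rfl; simp at hn
      by_cases hkn : k ≤ n
      · have : ¬ k ∣ n - k := fun h =>
          hn (Nat.sub_add_cancel hkn ▸ Nat.dvd_add h (dvd_refl k))
        simp [hn, hkn, this, h3]
      · simp [hn, hkn, h3]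

theorem elemProd_isInnerSeq (a : ℕ → R) (m : ℕ) : IsInnerSeq (elemProd a m) := by
  induction m with
  | zero =>
    refine ⟨1, 1, one_mul 1, fun n x => ?_⟩
    by_cases hn : n = 0 <;> simp [elemProd, hn, PowerSeries.coeff_C]
  | succ m ih => exact ih.seqConv (elemSeq_isInnerSeq _ (by omega))

theorem elemSeq_zero_apply (a : R) (k : ℕ) (x : R) : elemSeq a k 0 x = x := by
  simp [elemSeq]

theorem elemSeq_self_apply (a : R) {k : ℕ} (hk : 1 ≤ k) (x : R) : elemSeq a k k x = ⁅a, x⁆ := by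
  simp [elemSeq, show k ≠ 0 by omega, Nat.div_self (show 0 < k by omega), Ring.lie_def]

theorem elemSeq_of_lt (a : R) {k n : ℕ} (hn : n ≠ 0) (h : n < k) (x : R) :
    elemSeq a k n x = 0 := by
  have : ¬ k ∣ n := fun hd => by have := Nat.le_of_dvd (by omega) hd; omega
  simp [elemSeq, hn, this]

theorem elemProd_zero_apply (a : ℕ → R) (m : ℕ) (x : R) : elemProd a m 0 x = x := by
  induction m with
  | zero => simp [elemProd]
  | succ m ih => simp [elemProd, seqConv_apply, elemSeq_zero_apply, ih]

theorem elemProd_succ_of_le (a : ℕ → R) {m n : ℕ} (h : n ≤ m) (x : R) :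
    elemProd a (m + 1) n x = elemProd a m n x := by
  rw [elemProd, seqConv_apply, Finset.sum_eq_single (n, 0)]
  · simp [elemSeq_zero_apply]
  · rintro ⟨i, j⟩ hij hne
    have hij' : i + j = n := by simpa using hij
    have hj : j ≠ 0 := by rintro rfl; simp at hij'; simp [hij'] at hne
    simp [elemSeq_of_lt _ hj (show j < m + 1 by omega)]
  · simp

theorem elemProd_eq_innerHigherDer (a : ℕ → R) {m n : ℕ} (h : n ≤ m) (x : R) :
    elemProd a m n x = innerHigherDer a n x := by
  induction m, h using Nat.le_induction with
  | base => rfl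
  | succ m hm ih => rw [elemProd_succ_of_le a hm, ih]

/-- The newest parameter enters its own degree only through an inner derivation, so it can be chosen
inductively. -/
theorem innerHigherDer_succ (a : ℕ → R) (m : ℕ) (x : R) :
    innerHigherDer a (m + 1) x = elemProd a m (m + 1) x + ⁅a (m + 1), x⁆ := by
  rw [innerHigherDer, elemProd, seqConv_apply, Finset.sum_eq_add (m + 1, 0) (0, m + 1)]
  · simp [elemSeq_zero_apply, elemProd_zero_apply, elemSeq_self_apply]
  · simp
  · rintro ⟨i, j⟩ hij ⟨h1, h2⟩
    have hij' : i + j = m + 1 := by simpa using hij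
    have hj : j ≠ 0 := by rintro rfl; simp at hij'; simp [hij'] at h1
    have hi : i ≠ 0 := by rintro rfl; simp at hij'; simp [hij'] at h2
    simp [elemSeq_of_lt _ hj (show j < m + 1 by omega)]
  · simp
  · simp

theorem elemProd_congr {a b : ℕ → R} {m : ℕ} (h : ∀ i, 1 ≤ i → i ≤ m → a i = b i) (n : ℕ) (x : R) :
    elemProd a m n x = elemProd b m n x := by
  induction m generalizing n x with
  | zero => rfl
  | succ m ih =>
    simp only [elemProd, seqConv_apply, h (m + 1) (by omega) le_rfl]
    exact Finset.sum_congr rfl fun p _ => ih (fun i h1 h2 => h i h1 (by omega)) _ _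

theorem innerHigherDer_mul (a : ℕ → R) (n : ℕ) (x y : R) :
    innerHigherDer a n (x * y) = ∑ p ∈ Finset.HasAntidiagonal.antidiagonal n,
      innerHigherDer a p.1 x * innerHigherDer a p.2 y := by
  rw [innerHigherDer, (elemProd_isInnerSeq a n).map_mul]
  refine Finset.sum_congr rfl fun p hp => ?_
  have := Finset.HasAntidiagonal.mem_antidiagonal.1 hp
  rw [elemProd_eq_innerHigherDer a (by omega), elemProd_eq_innerHigherDer a (by omega)]

theorem sum_antidiagonal_lie_of_mul {d : ℕ → R →+ R} {n : ℕ}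
    (hd : ∀ x y, d n (x * y) = ∑ p ∈ Finset.HasAntidiagonal.antidiagonal n, d p.1 x * d p.2 y)
    (x y : R) :
    d n ⁅x, y⁆ = ∑ p ∈ Finset.HasAntidiagonal.antidiagonal n, ⁅d p.1 x, d p.2 y⁆ := by
  simp only [Ring.lie_def, map_sub, hd, Finset.sum_sub_distrib]
  congr 1
  refine Finset.sum_nbij' Prod.swap Prod.swap ?_ ?_ ?_ ?_ ?_ <;> simp [add_comm]

theorem elemProd_smul {𝕜 : Type*} [CommSemiring 𝕜] [Algebra 𝕜 R] (a : ℕ → R) (m n : ℕ) (c : 𝕜)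
    (x : R) : elemProd a m n (c • x) = c • elemProd a m n x := by
  induction m generalizing n x with
  | zero => by_cases hn : n = 0 <;> simp [elemProd, hn]
  | succ m ih =>
    have h (k j : ℕ) (x : R) : elemSeq (a k) k j (c • x) = c • elemSeq (a k) k j x := by
      unfold elemSeq
      split_ifs <;> simp [smul_sub]
    simp only [elemProd, seqConv_apply, h, ih, Finset.smul_sum]

end HigherDerivations

/-! ### Maps that are Lie derivable at zero products, via rank-one operators -/

section RankOne

theorem ContinuousLinearMap.lie_apply_eq {𝕜 V : Type*} [NormedField 𝕜] [NormedAddCommGroup V]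
    [NormedSpace 𝕜 V] (S T : V →L[𝕜] V) (x : V) : ⁅S, T⁆ x = S (T x) - T (S x) := rfl

/-- For an idempotent `p`, the zero products `(ap)(b - pb)` and `(a - ap)(pb)` give `φ(ap, b) = φ(a,
pb)`. Hence `φ(a, t) = φ(at, 1)` on the span of idempotents. Antisymmetry forces `φ(t, 1) = 0`
there; apply this to `t = as`. -/
theorem LinearMap.eq_zero_of_zero_product_of_idempotent {𝕜 A M : Type*} [Field 𝕜] [CharZero 𝕜]
    [Ring A] [Algebra 𝕜 A] [AddCommGroup M] [Module 𝕜 M] (φ : A →ₗ[𝕜] A →ₗ[𝕜] M)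
    (h0 : ∀ a b, a * b = 0 → φ a b = 0) (hanti : ∀ a b, φ a b = -φ b a) {s : A}
    (hs : ∀ a, a * s ∈ Submodule.span 𝕜 {p : A | IsIdempotentElem p}) (a : A) : φ a s = 0 := by
  have key (p : A) (hp : IsIdempotentElem p) (a b : A) : φ (a * p) b = φ a (p * b) := by
    have hp' : p * p = p := hp
    have e1 : φ (a * p) (b - p * b) = 0 :=
      h0 _ _ (by rw [mul_sub, mul_assoc, mul_assoc, ← mul_assoc p p b, hp', sub_self])
    have e2 : φ (a - a * p) (p * b) = 0 :=
      h0 _ _ (by rw [sub_mul, mul_assoc, ← mul_assoc p p b, hp', sub_self])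
    rw [map_sub, sub_eq_zero] at e1
    rw [map_sub, LinearMap.sub_apply, sub_eq_zero] at e2
    rw [e1, e2]
  have move : ∀ t ∈ Submodule.span 𝕜 {p : A | IsIdempotentElem p}, ∀ a, φ (a * t) 1 = φ a t := by
    intro t ht a
    induction ht using Submodule.span_induction with
    | mem p hp => simpa using key p hp a 1
    | zero => simp
    | add x y _ _ hx hy => simp only [mul_add, map_add, LinearMap.add_apply, hx, hy]
    | smul c x _ hx => simp only [mul_smul_comm, map_smul, LinearMap.smul_apply, hx]
  have van : ∀ t ∈ Submodule.span 𝕜 {p : A | IsIdempotentElem p}, φ t 1 = 0 := by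
    intro t ht
    have e := move t ht 1
    rw [one_mul, hanti 1 t] at e
    have e2 : (2 : 𝕜) • φ t 1 = 0 := by
      rw [two_smul]; exact add_eq_zero_iff_eq_neg.2 e
    exact (smul_eq_zero.1 e2).resolve_left two_ne_zero
  have hs1 : s ∈ Submodule.span 𝕜 {p : A | IsIdempotentElem p} := by simpa using hs 1
  rw [← move s hs1, van _ (hs a)]

/-- An algebra `A` acting on `V` by bounded operators, with elements `op x f` which act as the
rank-one operators `x ⊗ f`, where `f` runs through a space of functionals separating points. -/
structure RankOneSystem {𝕜 A V : Type*} [RCLike 𝕜] [NormedAddCommGroup V] [NormedSpace 𝕜 V]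
    [Ring A] [Algebra 𝕜 A] (ρ : A →ₐ[𝕜] (V →L[𝕜] V)) (W : Type*) [AddCommGroup W] [Module 𝕜 W] where
  pair : W →ₗ[𝕜] (V →L[𝕜] 𝕜)
  op : V →ₗ[𝕜] W →ₗ[𝕜] A
  adj : W → A → W
  map_op : ∀ x f y, ρ (op x f) y = pair f y • x
  mul_op : ∀ a x f, a * op x f = op (ρ a x) f
  op_mul : ∀ a x f, op x f * a = op x (adj f a)
  separating : ∀ x, (∀ f, pair f x = 0) → x = 0

namespace RankOneSystem

variable {𝕜 A V W : Type*} [RCLike 𝕜] [NormedAddCommGroup V] [NormedSpace 𝕜 V]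
  [Ring A] [Algebra 𝕜 A] {ρ : A →ₐ[𝕜] (V →L[𝕜] V)} [AddCommGroup W] [Module 𝕜 W]
  (S : RankOneSystem ρ W)

theorem op_mul_op (x y : V) (f g : W) : S.op x f * S.op y g = S.pair f y • S.op x g := by
  rw [S.mul_op, S.map_op, map_smul, LinearMap.smul_apply]

/-- If `f x ≠ 0`, then `x ⊗ f` is a multiple of an idempotent; otherwise write it as `x ⊗ (f + g) -
x ⊗ g` with `g x ≠ 0`. -/
theorem op_mem_span (x : V) (f : W) :
    S.op x f ∈ Submodule.span 𝕜 {p : A | IsIdempotentElem p} := by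
  have main (f : W) (h : S.pair f x ≠ 0) :
      S.op x f ∈ Submodule.span 𝕜 {p : A | IsIdempotentElem p} := by
    have : S.op x f = S.pair f x • ((S.pair f x)⁻¹ • S.op x f) := by
      rw [smul_smul, mul_inv_cancel₀ h, one_smul]
    rw [this]
    refine Submodule.smul_mem _ _ (Submodule.subset_span ?_)
    change _ * _ = _
    rw [smul_mul_smul_comm, S.op_mul_op, smul_smul]
    congr 1
    field_simp
  by_cases hx : x = 0
  · simp [hx]
  · by_cases hf : S.pair f x = 0
    · obtain ⟨g, hg⟩ : ∃ g, S.pair g x ≠ 0 := by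
        by_contra! h
        exact hx (S.separating x h)
      have : S.op x f = S.op x (f + g) - S.op x g := by simp
      rw [this]
      exact Submodule.sub_mem _ (main _ (by simpa [hf] using hg)) (main _ hg)
    · exact main f hf

theorem lie_op_of_zero_product {δ : A →ₗ[𝕜] (V →L[𝕜] V)}
    (hδ : ∀ a b, a * b = 0 → δ ⁅a, b⁆ = ⁅δ a, ρ b⁆ + ⁅ρ a, δ b⁆) (a : A) (x : V) (f : W) :
    δ ⁅a, S.op x f⁆ = ⁅δ a, ρ (S.op x f)⁆ + ⁅ρ a, δ (S.op x f)⁆ := by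
  -- The defect of the Lie identity is bilinear, antisymmetric and zero at zero products.
  let φ : A →ₗ[𝕜] A →ₗ[𝕜] (V →L[𝕜] V) := LinearMap.mk₂ 𝕜
    (fun a b => δ ⁅a, b⁆ - (⁅δ a, ρ b⁆ + ⁅ρ a, δ b⁆))
    (fun a a' b => by
      simp only [Ring.lie_def, map_add, map_sub, add_mul, mul_add]; abel)
    (fun c a b => by
      simp only [Ring.lie_def, map_smul, map_sub, smul_mul_assoc, mul_smul_comm, smul_sub, smul_add])
    (fun a b b' => by
      simp only [Ring.lie_def, map_add, map_sub, add_mul, mul_add]; abel)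
    (fun c a b => by
      simp only [Ring.lie_def, map_smul, map_sub, smul_mul_assoc, mul_smul_comm, smul_sub, smul_add])
  have hφ (a b : A) : φ a b = δ ⁅a, b⁆ - (⁅δ a, ρ b⁆ + ⁅ρ a, δ b⁆) := rfl
  have := φ.eq_zero_of_zero_product_of_idempotent (s := S.op x f)
    (fun a b h => by rw [hφ, hδ a b h, sub_self])
    (fun a b => by
      simp only [hφ, Ring.lie_def, map_sub]; abel)
    (fun a => by rw [S.mul_op]; exact S.op_mem_span _ _) a
  rwa [hφ, sub_eq_zero] at this

/-- Closed graph theorem: the separating functionals identify the limit. -/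
theorem continuous_of_pair_comp [CompleteSpace V] (τ : V →ₗ[𝕜] V)
    (h : ∀ f, Continuous fun x => S.pair f (τ x)) : Continuous τ := by
  refine τ.continuous_of_seq_closed_graph fun u x y hu hτ => ?_
  refine sub_eq_zero.1 (S.separating _ fun f => ?_)
  rw [map_sub, sub_eq_zero]
  exact tendsto_nhds_unique (((S.pair f).continuous.tendsto y).comp hτ)
    (((h f).tendsto x).comp hu)

/-- Evaluating `[D, x ⊗ f₀] = c` at `x` and applying `f₀` gives `c f₀(x) = 0`. So `c = 0` when `f₀ x
≠ 0`, and evaluation at `x₀` yields `D x = f₀(D x₀) x`. Vectors in `ker f₀` are reached through `x +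
x₀`. -/
theorem exists_eq_smul_one_of_lie_op {D : V →L[𝕜] V}
    (hD : ∀ x f, ∃ c : 𝕜, ⁅D, ρ (S.op x f)⁆ = c • 1) {x₀ : V} {f₀ : W} (h0 : S.pair f₀ x₀ = 1) :
    D = S.pair f₀ (D x₀) • (1 : V →L[𝕜] V) := by
  have hx₀ : x₀ ≠ 0 := by rintro rfl; simp at h0
  have key (x y : V) (h : S.pair f₀ x ≠ 0) : S.pair f₀ y • D x = S.pair f₀ (D y) • x := by
    obtain ⟨c, hc⟩ := hD x f₀
    have ev (z : V) : S.pair f₀ z • D x - S.pair f₀ (D z) • x = c • z := by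
      have := congrArg (fun T : V →L[𝕜] V => T z) hc
      simpa [Ring.lie_def, S.map_op] using this
    have hc0 : c = 0 := by
      have := congrArg (S.pair f₀) (ev x)
      simp only [map_sub, map_smul, smul_eq_mul] at this
      have h2 : c * S.pair f₀ x = 0 := by rw [← this]; ring
      exact (mul_eq_zero.1 h2).resolve_right h
    exact sub_eq_zero.1 (by rw [ev, hc0, zero_smul])
  ext x
  by_cases h : S.pair f₀ x = 0
  · have e1 := key (x + x₀) x₀ (by simp [h, h0])
    have e2 := key x₀ x₀ (by simp [h0])
    simp only [h0, one_smul, map_add, smul_add] at e1 e2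
    simpa using congrArg₂ (· - ·) e1 e2
  · have e1 := key x x₀ h
    simpa [h0] using e1


/-- The map `a ↦ [T, ρ a]`. -/
def _root_.innerMap (ρ : A →ₐ[𝕜] (V →L[𝕜] V)) (T : V →L[𝕜] V) : A →ₗ[𝕜] (V →L[𝕜] V) :=
  (LinearMap.mulLeft 𝕜 T - LinearMap.mulRight 𝕜 T) ∘ₗ ρ.toLinearMap

theorem _root_.innerMap_apply (T : V →L[𝕜] V) (a : A) : innerMap ρ T a = ⁅T, ρ a⁆ := rfl

/-- `δ [a, s] = [δ a, ρ s] + [ρ a, δ s]` for all `a` and all rank-one elements `s`. -/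
def IsLieOnOp (δ : A →ₗ[𝕜] (V →L[𝕜] V)) : Prop :=
  ∀ a x f, δ ⁅a, S.op x f⁆ = ⁅δ a, ρ (S.op x f)⁆ + ⁅ρ a, δ (S.op x f)⁆

variable {S} {δ : A →ₗ[𝕜] (V →L[𝕜] V)} {x₀ : V} {f₀ : W}

theorem IsLieOnOp.sub_innerMap (hδ : S.IsLieOnOp δ) (T : V →L[𝕜] V) :
    S.IsLieOnOp (δ - innerMap ρ T) := by
  intro a x f
  simp only [LinearMap.sub_apply, innerMap_apply, hδ a x f]
  simp only [Ring.lie_def, map_sub, map_mul]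
  noncomm_ring

theorem lie_op_left (h0 : S.pair f₀ x₀ = 1) {x : V} (hx : S.pair f₀ x = 0) :
    ⁅S.op x f₀, S.op x₀ f₀⁆ = S.op x f₀ := by
  simp [Ring.lie_def, S.op_mul_op, h0, hx]

theorem lie_op_right (h0 : S.pair f₀ x₀ = 1) {f : W} (hf : S.pair f x₀ = 0) :
    ⁅S.op x₀ f₀, S.op x₀ f⁆ = S.op x₀ f := by
  simp [Ring.lie_def, S.op_mul_op, h0, hf]

theorem IsLieOnOp.exists_normalize (hδ : S.IsLieOnOp δ) (h0 : S.pair f₀ x₀ = 1) :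
    ∃ (T : V →L[𝕜] V) (c : 𝕜), (δ - innerMap ρ T) (S.op x₀ f₀) = c • 1 := by
  set P := ρ (S.op x₀ f₀) with hP
  have hPP : P * P = P := by rw [hP, ← map_mul, S.op_mul_op, h0, one_smul]
  have Px (x : V) : P x = S.pair f₀ x • x₀ := S.map_op _ _ _
  set C := δ (S.op x₀ f₀) with hC
  -- `C - [[C, P], P] = PCP + (1 - P)C(1 - P)` is the block-diagonal part of `C`, so it commutes
  -- with `P`.
  refine ⟨⁅C, P⁆, ?_⟩
  set δ₁ := δ - innerMap ρ ⁅C, P⁆ with hδ₁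
  have hδ₁' : S.IsLieOnOp δ₁ := hδ.sub_innerMap _
  set D := δ₁ (S.op x₀ f₀) with hD
  have hDC : D = C - ⁅⁅C, P⁆, P⁆ := rfl
  have hcomm : D * P = P * D := by
    have e1 : C * P * P = C * P := by rw [mul_assoc, hPP]
    have e2 : P * (P * C) = P * C := by rw [← mul_assoc, hPP]
    rw [hDC]
    simp only [Ring.lie_def, sub_mul, mul_sub, e1, e2, ← mul_assoc]
    simp only [mul_assoc, hPP]
    abel
  have hc (x : V) : D (S.pair f₀ x • x₀) = S.pair f₀ (D x) • x₀ := by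
    rw [← Px, ← Px]; exact congrArg (fun T : V →L[𝕜] V => T x) hcomm
  have hker (x : V) (hx : S.pair f₀ x = 0) : D x = S.pair f₀ (D x₀) • x := by
    have e := hδ₁' (S.op x f₀) x₀ f₀
    rw [lie_op_left h0 hx, ← hP, ← hD] at e
    have e1 := congrArg (fun T : V →L[𝕜] V => T x₀) e
    simp only [ContinuousLinearMap.lie_apply_eq, add_apply, Px, S.map_op, h0, one_smul] at e1
    have hDx : S.pair f₀ (D x) = 0 := by
      have := congrArg (S.pair f₀) (hc x)
      simpa [hx, h0] using this.symm
    have e2 : S.pair f₀ (δ₁ (S.op x f₀) x₀) = 0 := by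
      have := congrArg (S.pair f₀) e1
      simpa [h0, hx, hDx] using this
    rw [e2, zero_smul, sub_zero, left_eq_add, sub_eq_zero] at e1
    exact e1.symm
  refine ⟨S.pair f₀ (D x₀), ?_⟩
  ext x
  have e1 := hker (x - S.pair f₀ x • x₀) (by simp [h0])
  have e2 := hc x₀
  rw [h0, one_smul] at e2
  rw [map_sub, map_smul, e2, smul_sub, smul_comm, map_smul, h0] at e1
  simpa using e1

section Normalized

variable {c : 𝕜}

theorem IsLieOnOp.op_left (hδ : S.IsLieOnOp δ) (h0 : S.pair f₀ x₀ = 1)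
    (hc : δ (S.op x₀ f₀) = c • 1) {x : V} (hx : S.pair f₀ x = 0) :
    S.pair f₀ (δ (S.op x f₀) x₀) = 0 ∧
      ∀ y, δ (S.op x f₀) y = S.pair f₀ y • δ (S.op x f₀) x₀ := by
  have e := hδ (S.op x f₀) x₀ f₀
  rw [lie_op_left h0 hx, hc] at e
  have ev (y : V) : δ (S.op x f₀) y =
      S.pair f₀ y • δ (S.op x f₀) x₀ - S.pair f₀ (δ (S.op x f₀) y) • x₀ := by
    simpa [Ring.lie_def, S.map_op] using congrArg (fun T : V →L[𝕜] V => T y) e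
  have h1 : S.pair f₀ (δ (S.op x f₀) x₀) = 0 := by
    simpa [h0] using congrArg (S.pair f₀) (ev x₀)
  refine ⟨h1, fun y => ?_⟩
  have h2 : S.pair f₀ (δ (S.op x f₀) y) = 0 := by
    have := congrArg (S.pair f₀) (ev y)
    simp only [map_sub, map_smul, smul_eq_mul, h1, h0] at this
    linear_combination this / 2
  rw [ev y, h2, zero_smul, sub_zero]

theorem IsLieOnOp.op_right (hδ : S.IsLieOnOp δ) (h0 : S.pair f₀ x₀ = 1)
    (hc : δ (S.op x₀ f₀) = c • 1) {f : W} (hf : S.pair f x₀ = 0) :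
    δ (S.op x₀ f) x₀ = 0 ∧ ∀ y, δ (S.op x₀ f) y = S.pair f₀ (δ (S.op x₀ f) y) • x₀ := by
  have e := hδ (S.op x₀ f₀) x₀ f
  rw [lie_op_right h0 hf, hc] at e
  have ev (y : V) : δ (S.op x₀ f) y =
      S.pair f₀ (δ (S.op x₀ f) y) • x₀ - S.pair f₀ y • δ (S.op x₀ f) x₀ := by
    simpa [Ring.lie_def, S.map_op] using congrArg (fun T : V →L[𝕜] V => T y) e
  have h1 : S.pair f₀ (δ (S.op x₀ f) x₀) = 0 := by
    simpa [h0] using congrArg (S.pair f₀) (ev x₀)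
  have h2 : δ (S.op x₀ f) x₀ = 0 := by
    have := ev x₀
    rw [h1, h0, zero_smul, one_smul, zero_sub] at this
    have e2 : (2 : 𝕜) • δ (S.op x₀ f) x₀ = 0 := by
      rw [two_smul]; exact add_eq_zero_iff_eq_neg.2 this
    exact (smul_eq_zero.1 e2).resolve_left two_ne_zero
  refine ⟨h2, fun y => ?_⟩
  conv_lhs => rw [ev y, h2, smul_zero, sub_zero]

/-- Comes from `[x ⊗ f₀, x₀ ⊗ f] = x ⊗ f - f(x) x₀ ⊗ f₀`: the values of `δ` on the two off-diagonal
blocks determine it on the remaining one. -/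
theorem IsLieOnOp.op_ker (hδ : S.IsLieOnOp δ) (h0 : S.pair f₀ x₀ = 1)
    (hc : δ (S.op x₀ f₀) = c • 1) {x : V} (hx : S.pair f₀ x = 0) {f : W} (hf : S.pair f x₀ = 0)
    (z : V) :
    δ (S.op x f) z = (S.pair f x * c) • z + S.pair f z • δ (S.op x f₀) x₀
      - (S.pair f₀ z * S.pair f (δ (S.op x f₀) x₀)) • x₀ + S.pair f₀ (δ (S.op x₀ f) z) • x
      - (S.pair f₀ z * S.pair f₀ (δ (S.op x₀ f) x)) • x₀ := by
  have e := hδ (S.op x f₀) x₀ f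
  have e0 : ⁅S.op x f₀, S.op x₀ f⁆ = S.op x f - S.pair f x • S.op x₀ f₀ := by
    simp [Ring.lie_def, S.op_mul_op, h0]
  rw [e0, map_sub, map_smul, hc, sub_eq_iff_eq_add] at e
  have ev := congrArg (fun T : V →L[𝕜] V => T z) e
  have hA := (hδ.op_left h0 hc hx).2 z
  have hB := (hδ.op_right h0 hc hf).2 x
  simp only [ContinuousLinearMap.lie_apply_eq, add_apply, S.map_op, smul_apply,
      one_apply_eq_self, map_smul] at ev
  rw [ev, hA, map_smul, smul_eq_mul]
  conv_lhs => rw [hB]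
  module

/-- The two off-diagonal blocks are dual up to sign, so a single operator can correct both. The
relation follows from `[x ⊗ f, x ⊗ f₀] = f(x) x ⊗ f₀` evaluated at `x₀`. -/
theorem IsLieOnOp.pair_op_left (hδ : S.IsLieOnOp δ) (h0 : S.pair f₀ x₀ = 1)
    (hc : δ (S.op x₀ f₀) = c • 1) {x : V} (hx : S.pair f₀ x = 0) {f : W} (hf : S.pair f x₀ = 0) :
    S.pair f (δ (S.op x f₀) x₀) = -S.pair f₀ (δ (S.op x₀ f) x) := by
  by_cases hx0 : x = 0
  · simp [hx0]
  have e := hδ (S.op x f) x f₀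
  have e0 : ⁅S.op x f, S.op x f₀⁆ = S.pair f x • S.op x f₀ := by
    simp [Ring.lie_def, S.op_mul_op, hx]
  rw [e0, map_smul] at e
  have ev := congrArg (fun T : V →L[𝕜] V => T x₀) e
  simp only [ContinuousLinearMap.lie_apply_eq, add_apply, S.map_op, smul_apply,
      map_smul, hf, h0, zero_smul, one_smul, hδ.op_ker h0 hc hx hf, map_add, map_sub, hx,
      (hδ.op_right h0 hc hf).1, map_zero] at ev
  have e3 : (2 * (S.pair f (δ (S.op x f₀) x₀) + S.pair f₀ (δ (S.op x₀ f) x))) • x = 0 := by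
    rw [← sub_eq_zero] at ev
    simp only [smul_eq_mul] at ev
    rw [← neg_eq_zero, ← ev]
    module
  have := (smul_eq_zero.1 e3).resolve_right hx0
  linear_combination this / 2

theorem IsLieOnOp.exists_scalar_on_op [CompleteSpace V] (hδ : S.IsLieOnOp δ)
    (h0 : S.pair f₀ x₀ = 1) (hc : δ (S.op x₀ f₀) = c • 1) :
    ∃ T : V →L[𝕜] V, ∀ x f, ∃ d : 𝕜, (δ - innerMap ρ T) (S.op x f) = d • 1 := by
  -- If `δ = [T, ·]` with `T x₀ = 0`, then `T x = δ(x ⊗ f₀) x₀`; here `x` is first projected to `ker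
  -- f₀` along `x₀`.
  let τ : V →ₗ[𝕜] V :=
    { toFun := fun x => δ (S.op (x - S.pair f₀ x • x₀) f₀) x₀
      map_add' := fun x y => by simp [add_smul]; abel
      map_smul' := fun a x => by simp [mul_smul, smul_sub] }
  have hk (x : V) : S.pair f₀ (x - S.pair f₀ x • x₀) = 0 := by simp [h0]
  have hτ (x : V) (hx : S.pair f₀ x = 0) : δ (S.op x f₀) x₀ = τ x := by
    simp [τ, hx]
  have hτ₀ : τ x₀ = 0 := by simp [τ, h0]
  have hfτ (x : V) : S.pair f₀ (τ x) = 0 := (hδ.op_left h0 hc (hk x)).1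
  have hσ (f : W) (hf : S.pair f x₀ = 0) (x : V) :
      S.pair f (τ x) = -S.pair f₀ (δ (S.op x₀ f) x) := by
    have e := hδ.pair_op_left h0 hc (hk x) hf
    rw [map_sub (δ _), map_smul (δ _), (hδ.op_right h0 hc hf).1, smul_zero, sub_zero] at e
    exact e
  have hf' (f : W) : S.pair (f - S.pair f x₀ • f₀) x₀ = 0 := by simp [h0]
  -- By duality, `f ∘ τ` is expressed through one bounded operator `δ(x₀ ⊗ f')`, with `f'` vanishing
  -- at `x₀`.
  have hcont : Continuous τ := by
    refine S.continuous_of_pair_comp τ fun f => ?_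
    have : (fun x => S.pair f (τ x)) = fun x =>
        -S.pair f₀ (δ (S.op x₀ (f - S.pair f x₀ • f₀)) x) := by
      ext x
      rw [← hσ _ (hf' f)]
      simp [hfτ]
    rw [this]
    fun_prop
  let T : V →L[𝕜] V := ⟨τ, hcont⟩
  have hT (x : V) : T x = τ x := rfl
  refine ⟨T, fun x f => ?_⟩
  have h1 : (δ - innerMap ρ T) (S.op x₀ f₀) = c • 1 := by
    ext z
    simp [innerMap_apply, Ring.lie_def, hc, S.map_op, hT, hτ₀, hfτ]
  have h2 (x : V) (hx : S.pair f₀ x = 0) : (δ - innerMap ρ T) (S.op x f₀) = 0 := by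
    ext z
    have := (hδ.op_left h0 hc hx).2 z
    simp [innerMap_apply, Ring.lie_def, S.map_op, hT, hfτ, this, hτ x hx]
  have h3 (f : W) (hf : S.pair f x₀ = 0) : (δ - innerMap ρ T) (S.op x₀ f) = 0 := by
    ext z
    have := (hδ.op_right h0 hc hf).2 z
    simp only [innerMap_apply, ContinuousLinearMap.lie_apply_eq, S.map_op, hT, LinearMap.sub_apply,
      sub_apply, map_smul, hτ₀, hσ f hf]
    rw [this]
    simp [h0]
  have h4 (x : V) (hx : S.pair f₀ x = 0) (f : W) (hf : S.pair f x₀ = 0) :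
      (δ - innerMap ρ T) (S.op x f) = (S.pair f x * c) • 1 := by
    ext z
    simp only [innerMap_apply, ContinuousLinearMap.lie_apply_eq, S.map_op, hT, LinearMap.sub_apply,
      sub_apply, map_smul,
      hδ.op_ker h0 hc hx hf, hτ x hx, hσ f hf, smul_apply,
      one_apply_eq_self]
    module
  have hx : x = (x - S.pair f₀ x • x₀) + S.pair f₀ x • x₀ := by simp
  have hf : f = (f - S.pair f x₀ • f₀) + S.pair f x₀ • f₀ := by simp
  refine ⟨S.pair (f - S.pair f x₀ • f₀) (x - S.pair f₀ x • x₀) * c +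
    S.pair f₀ x * (S.pair f x₀ * c), ?_⟩
  conv_lhs => rw [hx, hf]
  simp only [map_add _ (_ - _), LinearMap.add_apply, map_smul _ _ x₀, map_smul _ _ f₀,
    LinearMap.smul_apply, (δ - innerMap ρ T).map_add, (δ - innerMap ρ T).map_smul]
  rw [h4 _ (hk x) _ (hf' f), h2 _ (hk x), h3 _ (hf' f), h1]
  module

end Normalized

/-- A linear map that is Lie derivable at zero products is the sum of an inner derivation and a
scalar-valued map. -/
theorem exists_eq_lie_add_smul [CompleteSpace V] [Nontrivial V] (S : RankOneSystem ρ W)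
    (hδ : ∀ a b, a * b = 0 → δ ⁅a, b⁆ = ⁅δ a, ρ b⁆ + ⁅ρ a, δ b⁆) :
    ∃ (T : V →L[𝕜] V) (h : A →ₗ[𝕜] 𝕜), ∀ a, δ a = ⁅T, ρ a⁆ + h a • 1 := by
  obtain ⟨x₀, hx₀⟩ := exists_ne (0 : V)
  obtain ⟨f₀, h0⟩ : ∃ f₀, S.pair f₀ x₀ = 1 := by
    obtain ⟨f, hf⟩ : ∃ f, S.pair f x₀ ≠ 0 := by
      by_contra! h
      exact hx₀ (S.separating x₀ h)
    exact ⟨(S.pair f x₀)⁻¹ • f, by simp [hf]⟩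
  have hL : S.IsLieOnOp δ := S.lie_op_of_zero_product hδ
  obtain ⟨T₀, c, hc⟩ := hL.exists_normalize h0
  have hL₁ := hL.sub_innerMap T₀
  obtain ⟨T₁, hT₁⟩ := hL₁.exists_scalar_on_op h0 hc
  have hL₂ := hL₁.sub_innerMap T₁
  set δ₂ := δ - innerMap ρ T₀ - innerMap ρ T₁ with hδ₂
  have hs (a : A) : δ₂ a = S.pair f₀ (δ₂ a x₀) • 1 := by
    refine S.exists_eq_smul_one_of_lie_op (fun x f => ?_) h0
    -- For `s = x ⊗ f`, both `as` and `sa` are again rank-one elements, so `δ₂ [a, s]` is scalar,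
    -- while `[ρ a, δ₂ s] = 0`. Hence `[δ₂ a, ρ s]` is scalar.
    obtain ⟨d₁, h₁⟩ := hT₁ (ρ a x) f
    obtain ⟨d₂, h₂⟩ := hT₁ x (S.adj f a)
    obtain ⟨d₃, h₃⟩ := hT₁ x f
    have e := hL₂ a x f
    rw [Ring.lie_def a, S.mul_op, S.op_mul, map_sub, h₁, h₂, h₃] at e
    refine ⟨d₁ - d₂, ?_⟩
    rw [sub_smul, e]
    simp [Ring.lie_def]
  refine ⟨T₀ + T₁, (S.pair f₀).toLinearMap ∘ₗ
    (ContinuousLinearMap.apply 𝕜 V x₀).toLinearMap ∘ₗ δ₂, fun a => ?_⟩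
  have : δ a = δ₂ a + ⁅T₀, ρ a⁆ + ⁅T₁, ρ a⁆ := by
    simp only [hδ₂, LinearMap.sub_apply, innerMap_apply]
    abel
  rw [this, hs a]
  simp only [Ring.lie_def, add_mul, mul_add]
  simp
  abel

end RankOneSystem

end RankOne

/-! ### Induction on the degree -/

section LieHigherDerivations

/-- Dependent choice: stage `n` fixes the `n`-th entry for good, and the diagonal of the stages is
the sequence. -/
theorem exists_seq_of_forall_exists_update {α : Type*} [Nonempty α] (Q : ℕ → (ℕ → α) → Prop)
    (hcongr : ∀ n T T', (∀ i ≤ n, T i = T' i) → Q n T → Q n T')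
    (step : ∀ n T, (∀ m < n, Q m T) → ∃ t, Q n (Function.update T n t)) :
    ∃ T, ∀ n, Q n T := by
  have step' : ∀ n T, ∃ t, (∀ m < n, Q m T) → Q n (Function.update T n t) := by
    intro n T
    by_cases h : ∀ m < n, Q m T
    · obtain ⟨t, ht⟩ := step n T h
      exact ⟨t, fun _ => ht⟩
    · exact ⟨Classical.arbitrary α, fun h' => absurd h' h⟩
  choose t ht using step'
  let F : ℕ → ℕ → α := fun n => Nat.rec (fun _ => Classical.arbitrary α)
    (fun n T => Function.update T n (t n T)) n
  have hF (n : ℕ) : F (n + 1) = Function.update (F n) n (t n (F n)) := rfl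
  have hT (n i : ℕ) (h : i < n) : F n i = F (i + 1) i := by
    induction n, (show i + 1 ≤ n from h) using Nat.le_induction with
    | base => rfl
    | succ m hm ih => rw [hF m, Function.update_of_ne (by omega), ih (by omega)]
  refine ⟨fun i => F (i + 1) i, fun n => ?_⟩
  induction n using Nat.strong_induction_on with
  | _ n ih =>
    refine hcongr n (F (n + 1)) _ (fun i hi => hT (n + 1) i (by omega)) ?_
    rw [hF]
    exact ht n _ fun m hm => hcongr m _ _ (fun i hi => (hT n i (by omega)).symm) (ih m hm)

variable {𝕜 A R : Type*} [Field 𝕜] [Ring A] [Algebra 𝕜 A] [Ring R] [Algebra 𝕜 R]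

theorem lie_add_smul_one (x y : R) (c d : 𝕜) :
    ⁅x + c • (1 : R), y + d • (1 : R)⁆ = ⁅x, y⁆ := by
  simp only [Ring.lie_def, add_mul, mul_add, smul_mul_assoc, mul_smul_comm, one_mul, mul_one,
    smul_add, smul_comm c d]
  abel

theorem sum_lie_eq_innerHigherDer (T : ℕ → R) {f g : ℕ → R} {c d : ℕ → 𝕜} {x y : R}
    (hf : ∀ n, f n = innerHigherDer T n x + c n • 1)
    (hg : ∀ n, g n = innerHigherDer T n y + d n • 1) (n : ℕ) :
    ∑ p ∈ Finset.HasAntidiagonal.antidiagonal n, ⁅f p.1, g p.2⁆ = innerHigherDer T n ⁅x, y⁆ := by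
  rw [sum_antidiagonal_lie_of_mul (innerHigherDer_mul T n)]
  exact Finset.sum_congr rfl fun p _ => by rw [hf, hg, lie_add_smul_one]

theorem AlgHom.map_bracket (ρ : A →ₐ[𝕜] R) (a b : A) : ρ ⁅a, b⁆ = ⁅ρ a, ρ b⁆ := by
  simp [Ring.lie_def]

theorem map_lie_eq_of_map_eq_innerHigherDer {ρ : A →ₐ[𝕜] R} {Λ : ℕ → A →ₗ[𝕜] A} {T : ℕ → R}
    {c : ℕ → A → 𝕜} (hT : ∀ n a, ρ (Λ n a) = innerHigherDer T n (ρ a) + c n a • 1) {n : ℕ} {a b : A}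
    (hc : c n ⁅a, b⁆ = 0) :
    ρ (Λ n ⁅a, b⁆) =
      ρ (∑ p ∈ Finset.HasAntidiagonal.antidiagonal n, ⁅Λ p.1 a, Λ p.2 b⁆) := by
  rw [hT, hc, zero_smul, add_zero, map_sum, ρ.map_bracket]
  simp only [ρ.map_bracket]
  exact (sum_lie_eq_innerHigherDer T (fun n => hT n a) (fun n => hT n b) n).symm

theorem map_zero_eq_innerHigherDer {ρ : A →ₐ[𝕜] R} {Λ : ℕ → A →ₗ[𝕜] A}
    (hΛ₀ : Λ 0 = LinearMap.id) (T : ℕ → R) (a : A) :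
    ρ (Λ 0 a) = innerHigherDer T 0 (ρ a) + (0 : 𝕜) • 1 := by
  rw [hΛ₀, LinearMap.id_apply, innerHigherDer, elemProd_zero_apply, zero_smul, add_zero]

/-- `elemProd T k` obeys Leibniz' rule in every degree and agrees with `Λ` modulo scalars up to
degree `k`. Only the terms containing degree `0` survive the subtraction. -/
theorem map_sub_elemProd_lie {ρ : A →ₐ[𝕜] R} {Λ : ℕ → A →ₗ[𝕜] A} (hΛ₀ : Λ 0 = LinearMap.id)
    {T : ℕ → R} {k : ℕ} {h : ℕ → A → 𝕜}
    (hT : ∀ m ≤ k, ∀ a, ρ (Λ m a) = innerHigherDer T m (ρ a) + h m a • 1) {a b : A}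
    (hab : Λ (k + 1) ⁅a, b⁆ =
      ∑ p ∈ Finset.HasAntidiagonal.antidiagonal (k + 1), ⁅Λ p.1 a, Λ p.2 b⁆) :
    ρ (Λ (k + 1) ⁅a, b⁆) - elemProd T k (k + 1) (ρ ⁅a, b⁆) =
      ⁅ρ (Λ (k + 1) a) - elemProd T k (k + 1) (ρ a), ρ b⁆ +
        ⁅ρ a, ρ (Λ (k + 1) b) - elemProd T k (k + 1) (ρ b)⁆ := by
  rw [hab, map_sum, ρ.map_bracket a b,
    sum_antidiagonal_lie_of_mul ((elemProd_isInnerSeq T k).map_mul (k + 1)),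
    ← Finset.sum_sub_distrib, Finset.sum_eq_add (k + 1, 0) (0, k + 1)]
  · simp only [hΛ₀, LinearMap.id_apply, elemProd_zero_apply, Ring.lie_def, map_sub, map_mul]
    noncomm_ring
  · simp
  · rintro ⟨i, j⟩ hij ⟨h1, h2⟩
    have hij' : i + j = k + 1 := by simpa using hij
    have hj : j ≠ 0 := by rintro rfl; simp at hij'; simp [hij'] at h1
    have hi : i ≠ 0 := by rintro rfl; simp at hij'; simp [hij'] at h2
    rw [ρ.map_bracket, hT i (by omega), hT j (by omega), lie_add_smul_one,
      elemProd_eq_innerHigherDer T (by omega), elemProd_eq_innerHigherDer T (by omega), sub_self]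
  · simp
  · simp

theorem RankOneSystem.exists_innerHigherDer {𝕜 A V W : Type*} [RCLike 𝕜] [NormedAddCommGroup V]
    [NormedSpace 𝕜 V] [CompleteSpace V] [Nontrivial V] [Ring A] [Algebra 𝕜 A]
    {ρ : A →ₐ[𝕜] (V →L[𝕜] V)} [AddCommGroup W] [Module 𝕜 W] (S : RankOneSystem ρ W)
    {Λ : ℕ → A →ₗ[𝕜] A} (hΛ₀ : Λ 0 = LinearMap.id)
    (hΛ : ∀ (n : ℕ) (a b : A), a * b = 0 →
      Λ n ⁅a, b⁆ = ∑ p ∈ Finset.HasAntidiagonal.antidiagonal n, ⁅Λ p.1 a, Λ p.2 b⁆) :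
    ∃ (T : ℕ → V →L[𝕜] V) (h : ℕ → A →ₗ[𝕜] 𝕜),
      ∀ n a, ρ (Λ n a) = innerHigherDer T n (ρ a) + h n a • 1 := by
  suffices H : ∃ T : ℕ → V →L[𝕜] V, ∀ n, ∃ h : A →ₗ[𝕜] 𝕜,
      ∀ a, ρ (Λ n a) = innerHigherDer T n (ρ a) + h a • 1 by
    obtain ⟨T, hT⟩ := H
    choose h hh using hT
    exact ⟨T, h, hh⟩
  refine exists_seq_of_forall_exists_update _ (fun n T T' hTT' ⟨h, hh⟩ => ⟨h, fun a => ?_⟩)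
    fun n T hT => ?_
  · rw [hh, innerHigherDer, innerHigherDer, elemProd_congr fun i _ hi => hTT' i hi]
  · rcases n with _ | k
    · exact ⟨0, 0, map_zero_eq_innerHigherDer hΛ₀ _⟩
    · choose! h hh using hT
      let E : (V →L[𝕜] V) →ₗ[𝕜] (V →L[𝕜] V) :=
        { elemProd T k (k + 1) with map_smul' := elemProd_smul T k (k + 1) }
      let δ : A →ₗ[𝕜] (V →L[𝕜] V) := ρ.toLinearMap ∘ₗ Λ (k + 1) - E ∘ₗ ρ.toLinearMap
      have hδ (a : A) : δ a = ρ (Λ (k + 1) a) - elemProd T k (k + 1) (ρ a) := rfl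
      obtain ⟨t, g, hg⟩ := S.exists_eq_lie_add_smul (δ := δ) fun a b hab => by
        simp only [hδ]
        exact map_sub_elemProd_lie hΛ₀ (h := fun m a => h m a)
          (fun m hm => hh m (by omega)) (hΛ _ a b hab)
      refine ⟨t, g, fun a => ?_⟩
      rw [innerHigherDer_succ, Function.update_self,
        elemProd_congr (b := T) fun i _ hi => Function.update_of_ne (by omega) _ _, add_assoc,
        ← hg, hδ]
      abel

end LieHigherDerivations

/-! ### Rank-one operators in `Alg L` -/

section JSubspaceLattices

variable {𝕜 X : Type*} [RCLike 𝕜] [NormedAddCommGroup X] [NormedSpace 𝕜 X]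

/-- Restriction to a member of the lattice, as an algebra homomorphism. -/
def restrictHom {L : Set (ClosedSubmodule 𝕜 X)} {K : ClosedSubmodule 𝕜 X} (hK : K ∈ L) :
    algLat L →ₐ[𝕜] (K.toSubmodule →L[𝕜] K.toSubmodule) where
  toFun := restrictTo hK
  map_one' := rfl
  map_mul' _ _ := rfl
  map_zero' := rfl
  map_add' _ _ := rfl
  commutes' _ := rfl

theorem coe_restrictHom_apply {L : Set (ClosedSubmodule 𝕜 X)} {K : ClosedSubmodule 𝕜 X}
    (hK : K ∈ L) (A : algLat L) (x : K.toSubmodule) :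
    (restrictHom hK A x : X) = (A : X →L[𝕜] X) x := rfl

/-- The bounded functionals vanishing on `K₋`. -/
def lowerAnnihilator (L : Set (ClosedSubmodule 𝕜 X)) (K : ClosedSubmodule 𝕜 X) :
    Submodule 𝕜 (X →L[𝕜] 𝕜) where
  carrier := {f | ∀ x ∈ lowerPart L K, f x = 0}
  zero_mem' _ _ := rfl
  add_mem' hf hg x hx := by simp [hf x hx, hg x hx]
  smul_mem' c f hf x hx := by simp [hf x hx]

theorem ClosedSubmodule.exists_dual_ne_zero (M : ClosedSubmodule 𝕜 X) {x : X} (hx : x ∉ M) :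
    ∃ f : X →L[𝕜] 𝕜, (∀ y ∈ M, f y = 0) ∧ f x ≠ 0 := by
  have : IsClosed (M.toSubmodule : Set X) := M.isClosed
  have hne : M.toSubmodule.mkQL x ≠ 0 := by
    intro h
    rw [Submodule.mkQL_apply, Submodule.mkQ_apply, Submodule.Quotient.mk_eq_zero] at h
    exact hx h
  obtain ⟨g, -, hg⟩ := exists_dual_vector 𝕜 (M.toSubmodule.mkQL x) (norm_ne_zero_iff.2 hne)
  refine ⟨g.comp M.toSubmodule.mkQL, fun y hy => ?_, ?_⟩
  · have : M.toSubmodule.mkQL y = 0 := by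
      rw [Submodule.mkQL_apply, Submodule.mkQ_apply, Submodule.Quotient.mk_eq_zero]
      exact hy
    rw [ContinuousLinearMap.comp_apply, this, map_zero]
  · rw [ContinuousLinearMap.comp_apply, hg]
    exact_mod_cast norm_ne_zero_iff.2 hne

theorem smulRight_mem_algLat {L : Set (ClosedSubmodule 𝕜 X)} {K : ClosedSubmodule 𝕜 X}
    {x : X} (hx : x ∈ K) {f : X →L[𝕜] 𝕜} (hf : f ∈ lowerAnnihilator L K) :
    f.smulRight x ∈ algLat L := by
  intro M hM y hy
  by_cases hKM : K ≤ M
  · exact M.toSubmodule.smul_mem _ (hKM hx)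
  · have : y ∈ lowerPart L K := (le_sSup (a := M) ⟨hM, hKM⟩ : M ≤ lowerPart L K) hy
    rw [ContinuousLinearMap.smulRight_apply, hf y this, zero_smul]
    exact zero_mem M

theorem mem_of_mem_setJ {L : Set (ClosedSubmodule 𝕜 X)} {K : ClosedSubmodule 𝕜 X}
    (hK : K ∈ setJ L) : K ∈ L := hK.1

theorem lowerPart_mem {L : Set (ClosedSubmodule 𝕜 X)} (hL : IsSubspaceLattice L)
    (K : ClosedSubmodule 𝕜 X) : lowerPart L K ∈ L :=
  hL.sSup_mem _ fun _ hM => hM.1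

/-- The rank-one operators `x ⊗ f` with `x ∈ K` and `f` vanishing on `K₋`. -/
def IsJSubspaceLattice.rankOneSystem {L : Set (ClosedSubmodule 𝕜 X)} (hL : IsJSubspaceLattice L)
    {K : ClosedSubmodule 𝕜 X} (hK : K ∈ setJ L) :
    RankOneSystem (restrictHom (mem_of_mem_setJ hK)) (lowerAnnihilator L K) where
  pair := { toFun := fun f => (f : X →L[𝕜] 𝕜).comp K.toSubmodule.subtypeL
            map_add' := fun _ _ => rfl
            map_smul' := fun _ _ => rfl }
  op := LinearMap.mk₂ 𝕜
    (fun x f => ⟨(f : X →L[𝕜] 𝕜).smulRight (x : X), smulRight_mem_algLat x.2 f.2⟩)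
    (fun x x' f => by ext; simp)
    (fun c x f => by ext z; exact smul_comm ((f : X →L[𝕜] 𝕜) z) c (x : X))
    (fun x f f' => by ext; simp [add_smul])
    (fun c x f => by ext; simp [mul_smul])
  adj f A := ⟨(f : X →L[𝕜] 𝕜).comp (A : X →L[𝕜] X),
    fun x hx => f.2 _ (A.2 _ (lowerPart_mem hL.toIsSubspaceLattice K) x hx)⟩
  map_op _ _ _ := rfl
  mul_op A x f := by ext; simp [coe_restrictHom_apply]
  op_mul A x f := by ext; simp
  separating x hx := by
    by_contra hne
    -- Since `K ∩ K₋ = 0`, Hahn–Banach on `X / K₋` separates the points of `K`.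
    have hx' : (x : X) ∉ lowerPart L K := fun h => by
      have : (x : X) ∈ K ⊓ lowerPart L K := ⟨x.2, h⟩
      rw [hL.inf_lowerPart K hK] at this
      exact hne (Subtype.ext this)
    obtain ⟨f, hf, hfx⟩ := (lowerPart L K).exists_dual_ne_zero hx'
    exact hfx (hx ⟨f, hf⟩)

theorem IsJSubspaceLattice.ext_restrictHom {L : Set (ClosedSubmodule 𝕜 X)}
    (hL : IsJSubspaceLattice L) {A B : algLat L}
    (h : ∀ K ∈ setJ L, ∀ hK : K ∈ L, restrictHom hK A = restrictHom hK B) :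
    A = B := by
  let E : ClosedSubmodule 𝕜 X := (⊥ : ClosedSubmodule 𝕜 X).comap ((A : X →L[𝕜] X) - (B : X →L[𝕜] X))
  have hE : sSup (setJ L) ≤ E := sSup_le fun K hK x hx => by
    have := congrArg (fun T : K.toSubmodule →L[𝕜] K.toSubmodule => (T ⟨x, hx⟩ : X)) (h K hK (mem_of_mem_setJ hK))
    exact sub_eq_zero.2 this
  rw [hL.span_setJ] at hE
  ext x
  exact sub_eq_zero.1 (hE (ClosedSubmodule.mem_top (x := x)))

end JSubspaceLattices

/-! ### The characterization -/

theorem mainTheorem1 {𝕜 X : Type*} [RCLike 𝕜] [NormedAddCommGroup X] [NormedSpace 𝕜 X]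
    [CompleteSpace X] (L : Set (ClosedSubmodule 𝕜 X)) (hL : IsJSubspaceLattice L)
    (Λ : ℕ → algLat L →ₗ[𝕜] algLat L) (hΛ : Λ 0 = LinearMap.id) :
    (∀ (n : ℕ) (A B : algLat L), A * B = 0 →
        Λ n ⁅A, B⁆ = ∑ p ∈ Finset.HasAntidiagonal.antidiagonal n, ⁅Λ p.1 A, Λ p.2 B⁆) ↔
      ∀ (K : ClosedSubmodule 𝕜 X) (hK : K ∈ setJ L),
        ∃ (T : ℕ → K.toSubmodule →L[𝕜] K.toSubmodule)
          (Δ : ℕ → algLat L →ₗ[𝕜] algLat L) (h : ℕ → algLat L →ₗ[𝕜] 𝕜),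
          (∀ n, 1 ≤ n → ∀ A : algLat L,
            restrictTo hK.1 (Δ n A) = innerHigherDer T n (restrictTo hK.1 A)) ∧
          (∀ n, ∀ A B : algLat L, A * B = 0 → h n ⁅A, B⁆ = 0) ∧
          (∀ n, 1 ≤ n → ∀ (A : algLat L), ∀ x ∈ K,
            (Λ n A : X →L[𝕜] X) x =
              (Δ n A : X →L[𝕜] X) x + (h n A • (1 : X →L[𝕜] X)) x) := by
  constructor
  · intro hLie K hK
    have : CompleteSpace K.toSubmodule := K.isClosed.completeSpace_coe
    have : Nontrivial K.toSubmodule := (Submodule.nontrivial_iff_ne_bot).2 fun h =>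
      hK.2.1 (ClosedSubmodule.toSubmodule_injective h)
    obtain ⟨T, h, hT⟩ := (hL.rankOneSystem hK).exists_innerHigherDer hΛ hLie
    refine ⟨T, fun n => Λ n - (h n).smulRight 1, h, fun n _ A => ?_, fun n A B hAB => ?_,
      fun n _ A x _ => ?_⟩
    · change restrictHom (mem_of_mem_setJ hK) _ =
        innerHigherDer T n (restrictHom (mem_of_mem_setJ hK) A)
      rw [LinearMap.sub_apply, map_sub, hT, LinearMap.smulRight_apply, map_smul, map_one,
        add_sub_cancel_right]
    · have e := hT n ⁅A, B⁆
      rw [hLie n A B hAB, map_sum, AlgHom.map_bracket] at e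
      simp only [AlgHom.map_bracket] at e
      -- The sum already equals `Δ_n` of the commutator, so `h_n [A, B]` acts as zero on `K ≠ 0`.
      rw [sum_lie_eq_innerHigherDer T (fun n => hT n A) (fun n => hT n B), left_eq_add] at e
      exact (smul_eq_zero.1 e).resolve_right one_ne_zero
    · simp
  · intro H n A B hAB
    refine hL.ext_restrictHom fun K hK hKL => ?_
    obtain ⟨T, Δ, h, hΔ, hh, hΛΔ⟩ := H K hK
    obtain ⟨g, hg, hT⟩ : ∃ g : ℕ → algLat L → 𝕜, (∀ n, g n ⁅A, B⁆ = 0) ∧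
        ∀ n C, restrictHom hKL (Λ n C) = innerHigherDer T n (restrictHom hKL C) +
          g n C • (1 : K.toSubmodule →L[𝕜] K.toSubmodule) := by
      -- The representation is given only for `n ≥ 1`; in degree `0`, `L_0 = id` needs scalar part
      -- `0`, whatever `h 0` is.
      refine ⟨fun n C => if n = 0 then 0 else h n C, fun n => by simp [hh n A B hAB],
        fun n C => ?_⟩
      dsimp only
      by_cases hn : n = 0
      · subst hn
        rw [if_pos rfl]
        exact map_zero_eq_innerHigherDer hΛ T C
      · have e : innerHigherDer T n (restrictHom hKL C) = restrictHom hKL (Δ n C) :=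
          (hΔ n (by omega) C).symm
        rw [e, if_neg hn]
        ext x
        exact hΛΔ n (by omega) C x x.2
    exact map_lie_eq_of_map_eq_innerHigherDer hT (hg n)
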